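/- Let $n \ge 2$. There exists a compact set $E \subset \mathbb{R}^n$ of Hausdorff dimension $n/4$ such that: (i) $E$ does not contain three distinct points $x, y, z$ for which the angle $\alpha = \angle yxz$ (with vertex $x$) has $\cos^2\alpha$ rational; (ii) $E$ does not contain four distinct points $x, y, z, v$ such that the vectors $x-y$ and $z-v$ form an angle $\alpha$ with $\cos^2\alpha$ rational. -/

import Mathlib

open scoped ENNReal

/-! The set `E` is a Cantor set whose points are extremely well approximated by lattice points with
prescribed residues. With `N = 2 ^ scale k`, each stage `k` box has its corner in the lattice of
mesh `1 / N` and side `N⁻⁴ / 4 ^ k`.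

Angles: `cos² = q` makes the quartic form `q.den (u·w)² - q.num |u|²|w|²` vanish at `u = x - y`, `w
= z - v`. Replacing the points by corners and scaling by `N` gives integer vectors and changes the
form by a constant depending on `q` and `n` times `4⁻ᵏ`, so eventually by less than `1`; the integer
form must then vanish too. But `ρ` makes the corners near `x`, `y`, `z`, `v` congruent to `e₀`, `0`,
`e₀` or `e₁`, `0` modulo `2 ^ k`, so the integer form is congruent to `1` (if `q = 0`) or to
`-q.num`, which is nonzero for large `k`. Each configuration recurs at infinitely many stages
(`exists_residues`, `angleForm_ne_zero`).

Dimension: about `Nⁿ` boxes of side at most `N⁻⁴` cover `E`, so the dimension is at most `n / 4`.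
Conversely, stages grow so fast that the map from `E` back to the unit cube is Hölder of every
exponent below `1 / 4` (`dist_le_rpow`). -/

namespace LatticeCantor

/-! ### Construction of the Cantor set and its compactness -/

section

open Set Filter Topology

/-- The stage `k` lattice is `2 ^ (-scale k) ℤⁿ`. -/
def scale : ℕ → ℕ
  | 0 => 0
  | k + 1 => (k + 2) * (4 * scale k + 3 * k + 1)

/-- The ratio between the stage `k + 1` lattice and the number of its points used in each box
is `2 ^ gap k`. -/
def gap (k : ℕ) : ℕ := 4 * scale k + 3 * k + 1

/-- The side length of the boxes of stage `k`. -/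
noncomputable def side (k : ℕ) : ℝ := 1 / 2 ^ (4 * scale k + 2 * k)

lemma scale_succ (k : ℕ) : scale (k + 1) = (k + 1) * gap k + gap k := by
  simp only [scale, gap]; ring

lemma scale_add_lt (k : ℕ) : scale k + (k + 1) ≤ scale (k + 1) := by
  rw [scale_succ, gap]; nlinarith

lemma le_scale (k : ℕ) : k ≤ scale k := by
  induction k with
  | zero => simp
  | succ k ih => have := scale_add_lt k; omega

lemma side_pos (k : ℕ) : 0 < side k := by unfold side; positivity

lemma side_le (k : ℕ) : side k ≤ 1 / 2 ^ scale k := by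
  unfold side
  apply one_div_le_one_div_of_le (by positivity)
  exact pow_le_pow_right₀ (by norm_num) (by omega)

lemma tendsto_side : Tendsto side atTop (𝓝 0) := by
  refine squeeze_zero (fun k => (side_pos k).le) (fun k => ?_)
    (tendsto_pow_atTop_nhds_zero_of_lt_one (r := (1 / 2 : ℝ)) (by norm_num) (by norm_num))
  rw [one_div_pow]
  refine (side_le k).trans ?_
  apply one_div_le_one_div_of_le (by positivity)
  exact pow_le_pow_right₀ (by norm_num) (le_scale k)

/-- This is why the `2 ^ ((k + 1) * gap k)` children per axis, spaced `2 ^ (k + 1)` fine lattice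
steps apart, fill a box exactly. -/
lemma two_pow_gap (k : ℕ) : side k = 2 ^ (k + 1) / 2 ^ gap k := by
  rw [side, gap, div_eq_div_iff (by positivity) (by positivity), one_mul, ← pow_add]
  congr 1; ring

/-- The sequences of digits coding the points of the Cantor set. -/
abbrev Code (n : ℕ) : Type := (k : ℕ) → Fin n → Fin (2 ^ ((k + 1) * gap k))

variable {n : ℕ}

/-- The lattice point with integer coordinates `a` at stage `k`. -/
noncomputable def pt (k : ℕ) (a : Fin n → ℕ) : Fin n → ℝ := fun j => a j / 2 ^ scale k

/-- The integer coordinates of the corner of the stage `k` box determined by a code; `ρ`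
prescribes the residues modulo `2 ^ (k + 1)` of the coordinates at stage `k + 1`. -/
noncomputable def node (ρ : ℕ → (Fin n → ℝ) → Fin n → ℕ) (ω : Code n) : ℕ → Fin n → ℕ
  | 0 => 0
  | k + 1 => fun j => 2 ^ (scale (k + 1) - scale k) * node ρ ω k j + 2 ^ (k + 1) * ω k j
      + ρ k (pt k (node ρ ω k)) j

/-- The point with a given code. -/
noncomputable def point (ρ : ℕ → (Fin n → ℝ) → Fin n → ℕ) (ω : Code n) : Fin n → ℝ :=
  fun j => ⨆ k, pt k (node ρ ω k) j

variable {ρ : ℕ → (Fin n → ℝ) → Fin n → ℕ}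

lemma pt_node_succ (ω : Code n) (k : ℕ) (j : Fin n) :
    pt (k + 1) (node ρ ω (k + 1)) j = pt k (node ρ ω k) j +
      (2 ^ (k + 1) * (ω k j : ℕ) + ρ k (pt k (node ρ ω k)) j) / 2 ^ scale (k + 1) := by
  have h : (2 : ℝ) ^ scale (k + 1) = 2 ^ (scale (k + 1) - scale k) * 2 ^ scale k := by
    rw [← pow_add]; congr 1; have := scale_add_lt k; omega
  simp only [pt, node]
  push_cast
  rw [h]
  field_simp
  ring

lemma pt_node_mono (ω : Code n) (j : Fin n) : Monotone fun k => pt k (node ρ ω k) j := by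
  refine monotone_nat_of_le_succ fun k => ?_
  rw [pt_node_succ]
  have : (0 : ℝ) ≤ (2 ^ (k + 1) * (ω k j : ℕ) + ρ k (pt k (node ρ ω k)) j)
    / 2 ^ scale (k + 1) := by positivity
  linarith

/-- The boxes are nested: the last child still fits, since a residue at most `1` plus one fine step
for the child box is at most the spacing `2 ^ (k + 1)`. -/
lemma pt_node_add_side_anti (hρ : ∀ k p j, ρ k p j ≤ 1) (ω : Code n) (j : Fin n) :
    Antitone fun k => pt k (node ρ ω k) j + side k := by
  refine antitone_nat_of_succ_le fun k => ?_
  rw [pt_node_succ]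
  have h1 : (ρ k (pt k (node ρ ω k)) j : ℝ) ≤ 1 := by exact_mod_cast hρ _ _ _
  have h2 : ((ω k j : ℕ) : ℝ) + 1 ≤ 2 ^ ((k + 1) * gap k) := by exact_mod_cast (ω k j).2
  have h3 : (2 : ℝ) ≤ 2 ^ (k + 1) := by
    calc (2 : ℝ) = 2 ^ 1 := by norm_num
      _ ≤ _ := pow_le_pow_right₀ (by norm_num) (by omega)
  have h4 : side k = 2 ^ (k + 1) * 2 ^ ((k + 1) * gap k) / 2 ^ scale (k + 1) := by
    rw [two_pow_gap, scale_succ, pow_add _ ((k + 1) * gap k) (gap k)]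
    field_simp
  have h5 := side_le (k + 1)
  have h6 : (2 ^ (k + 1) * (ω k j : ℕ) + ρ k (pt k (node ρ ω k)) j) / 2 ^ scale (k + 1)
      + 1 / 2 ^ scale (k + 1) ≤ side k := by
    rw [h4, ← add_div]
    gcongr
    nlinarith
  linarith

lemma point_mem_Icc (hρ : ∀ k p j, ρ k p j ≤ 1) (ω : Code n) (k : ℕ) (j : Fin n) :
    point ρ ω j ∈ Icc (pt k (node ρ ω k) j) (pt k (node ρ ω k) j + side k) :=
  mem_iInter.1 ((pt_node_mono ω j).ciSup_mem_iInter_Icc_of_antitone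
    (pt_node_add_side_anti hρ ω j) fun k => le_add_of_nonneg_right (side_pos k).le) k

lemma dist_point_pt_le (hρ : ∀ k p j, ρ k p j ≤ 1) (ω : Code n) (k : ℕ) :
    dist (point ρ ω) (pt k (node ρ ω k)) ≤ side k := by
  refine (dist_pi_le_iff (side_pos k).le).2 fun j => ?_
  have := point_mem_Icc hρ ω k j
  rw [Real.dist_eq, abs_le]
  constructor <;> linarith [this.1, this.2, side_pos k]

lemma point_mem_unit (hρ : ∀ k p j, ρ k p j ≤ 1) (ω : Code n) (j : Fin n) :
    point ρ ω j ∈ Icc (0 : ℝ) 1 := by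
  simpa [pt, node, side, scale] using point_mem_Icc hρ ω 0 j

lemma continuous_node (k : ℕ) : Continuous fun ω : Code n => node ρ ω k := by
  induction k with
  | zero => exact continuous_const
  | succ k ih =>
    have h : Continuous fun q : (Fin n → ℕ) × (Fin n → Fin (2 ^ ((k + 1) * gap k))) =>
        fun j => 2 ^ (scale (k + 1) - scale k) * q.1 j + 2 ^ (k + 1) * (q.2 j : ℕ)
          + ρ k (pt k q.1) j := continuous_of_discreteTopology
    exact h.comp (ih.prodMk (continuous_apply k))

lemma continuous_point (hρ : ∀ k p j, ρ k p j ≤ 1) : Continuous (point (n := n) ρ) := by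
  refine continuous_of_uniform_approx_of_continuous fun u hu => ?_
  obtain ⟨ε, hε, hu⟩ := Metric.mem_uniformity_dist.1 hu
  obtain ⟨k, hk⟩ := (tendsto_side.eventually (gt_mem_nhds hε)).exists
  exact ⟨fun ω => pt k (node ρ ω k),
    (continuous_of_discreteTopology (f := fun a : Fin n → ℕ => pt k a)).comp (continuous_node k),
    fun ω => hu ((dist_point_pt_le hρ ω k).trans_lt hk)⟩

lemma isCompact_range_point (hρ : ∀ k p j, ρ k p j ≤ 1) :
    IsCompact (range (point (n := n) ρ)) :=
  isCompact_range (continuous_point hρ)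

end

/-! ### Upper bound for the dimension -/

section

open Set Filter Topology MeasureTheory

variable {n : ℕ} {ρ : ℕ → (Fin n → ℝ) → Fin n → ℕ}

lemma dimH_range_point_le (hρ : ∀ k p j, ρ k p j ≤ 1) :
    dimH (range (point (n := n) ρ)) ≤ (n : ℝ≥0∞) / 4 := by
  have key : μH[((n / 4 : NNReal) : ℝ)] (range (point (n := n) ρ)) ≤ 2 ^ n := by
    refine (Measure.hausdorffMeasure_le_liminf_sum (l := atTop)
      (ι := fun k => Fin n → Fin (2 ^ scale k + 1)) _ _ (fun k => ENNReal.ofReal (side k))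
      (by simpa using ENNReal.tendsto_ofReal tendsto_side)
      (fun k a => univ.pi fun j => Icc (pt k (fun i => (a i : ℕ)) j)
        (pt k (fun i => (a i : ℕ)) j + side k)) (Eventually.of_forall fun k a => ?_)
      (Eventually.of_forall fun k => ?_)).trans ?_
    · refine Metric.ediam_pi_le_of_le fun j => ?_
      rw [Real.ediam_Icc]; simp
    · rintro _ ⟨ω, rfl⟩
      have hlt (j : Fin n) : node ρ ω k j < 2 ^ scale k + 1 := by
        have h := (point_mem_Icc hρ ω k j).1.trans (point_mem_unit hρ ω j).2
        rw [pt, div_le_one (by positivity)] at h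
        have : node ρ ω k j ≤ 2 ^ scale k := by exact_mod_cast h
        omega
      exact mem_iUnion.2 ⟨fun j => ⟨node ρ ω k j, hlt j⟩, fun j _ => point_mem_Icc hρ ω k j⟩
    · refine (liminf_le_liminf (v := fun _ => (2 : ℝ≥0∞) ^ n) ?_).trans (by simp)
      refine Eventually.of_forall fun k => ?_
      have h1 : ∀ a : Fin n → Fin (2 ^ scale k + 1),
          Metric.ediam (univ.pi fun j => Icc (pt k (fun i => (a i : ℕ)) j)
            (pt k (fun i => (a i : ℕ)) j + side k)) ^ ((n / 4 : NNReal) : ℝ)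
          ≤ ENNReal.ofReal (side k ^ ((n : ℝ) / 4)) := by
        intro a
        have hd : Metric.ediam (univ.pi fun j => Icc (pt k (fun i => (a i : ℕ)) j)
            (pt k (fun i => (a i : ℕ)) j + side k)) ≤ ENNReal.ofReal (side k) := by
          refine Metric.ediam_pi_le_of_le fun j => ?_
          rw [Real.ediam_Icc]; simp
        rw [← ENNReal.ofReal_rpow_of_pos (side_pos k)]
        simpa using ENNReal.rpow_le_rpow hd (by positivity : (0 : ℝ) ≤ (n : ℝ) / 4)
      refine (Finset.sum_le_sum fun a _ => h1 a).trans ?_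
      have h2 : side k ^ ((n : ℝ) / 4) ≤ (1 / 2 ^ scale k) ^ n := by
        -- The exponent `4` here is the source of the dimension `n / 4`.
        have : side k ≤ (1 / 2 ^ scale k) ^ 4 := by
          rw [side, one_div_pow, ← pow_mul]
          apply one_div_le_one_div_of_le (by positivity)
          exact pow_le_pow_right₀ (by norm_num) (by omega)
        calc side k ^ ((n : ℝ) / 4) ≤ ((1 / 2 ^ scale k) ^ 4) ^ ((n : ℝ) / 4) :=
              Real.rpow_le_rpow (side_pos k).le this (by positivity)
          _ = (1 / 2 ^ scale k) ^ n := by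
              rw [← Real.rpow_natCast _ 4, ← Real.rpow_mul (by positivity),
                show ((4 : ℕ) : ℝ) * ((n : ℝ) / 4) = n by push_cast; ring, Real.rpow_natCast]
      rw [Finset.sum_const, Finset.card_univ, Fintype.card_fun, Fintype.card_fin, Fintype.card_fin,
        nsmul_eq_mul]
      calc (((2 ^ scale k + 1) ^ n : ℕ) : ℝ≥0∞) * ENNReal.ofReal (side k ^ ((n : ℝ) / 4))
          ≤ ENNReal.ofReal ((2 * 2 ^ scale k) ^ n) * ENNReal.ofReal ((1 / 2 ^ scale k) ^ n) := by
            gcongr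
            rw [← ENNReal.ofReal_natCast]
            apply ENNReal.ofReal_le_ofReal
            push_cast
            gcongr
            have : (1 : ℝ) ≤ 2 ^ scale k := one_le_pow₀ (by norm_num)
            linarith
        _ = 2 ^ n := by
            rw [← ENNReal.ofReal_mul (by positivity), ← mul_pow, mul_assoc,
              mul_one_div_cancel (by positivity), mul_one, ENNReal.ofReal_pow (by norm_num)]
            simp
  have := dimH_le_of_hausdorffMeasure_ne_top (ne_top_of_le_ne_top (by simp) key)
  refine this.trans_eq ?_
  rw [ENNReal.coe_div (by norm_num)]
  simp

end

/-! ### Lower bound for the dimension, by a Hölder inverse -/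

section

open Set Filter Topology

variable {n : ℕ} {ρ : ℕ → (Fin n → ℝ) → Fin n → ℕ}

/-- The number of binary digits consumed by the first `k` stages of a code. -/
def digits : ℕ → ℕ
  | 0 => 0
  | k + 1 => digits k + (k + 1) * gap k

lemma le_digits (k : ℕ) : k ≤ digits k := by
  induction k with
  | zero => simp
  | succ k ih => rw [digits]; unfold gap; nlinarith [Nat.zero_le (scale k)]

/-- The truncations of the binary expansions of the coordinates of `t`. -/
noncomputable def trunc (t : Fin n → ℝ) (k : ℕ) : Fin n → ℕ := fun j => ⌊2 ^ digits k * t j⌋₊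

/-- The code formed by the binary digits of `t`. -/
noncomputable def code (t : Fin n → ℝ) : Code n := fun k j =>
  ⟨trunc t (k + 1) j % 2 ^ ((k + 1) * gap k), Nat.mod_lt _ (by positivity)⟩

lemma trunc_succ_div (t : Fin n → ℝ) (k : ℕ) (j : Fin n) :
    trunc t (k + 1) j / 2 ^ ((k + 1) * gap k) = trunc t k j := by
  simp only [trunc, digits]
  rw [← Nat.floor_div_natCast]
  congr 1
  push_cast
  rw [pow_add]
  field_simp

lemma trunc_succ (t : Fin n → ℝ) (k : ℕ) (j : Fin n) :
    trunc t (k + 1) j = 2 ^ ((k + 1) * gap k) * trunc t k j + code t k j := by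
  rw [← trunc_succ_div t k j]
  exact (Nat.div_add_mod _ _).symm

lemma trunc_congr {s t : Fin n → ℝ} {k : ℕ} (h : trunc s k = trunc t k) :
    ∀ i ≤ k, trunc s i = trunc t i := by
  intro i hi
  induction k, hi using Nat.le_induction with
  | base => exact h
  | succ k _ ih =>
    refine ih ?_
    funext j
    rw [← trunc_succ_div, h, trunc_succ_div]

lemma node_code_congr {s t : Fin n → ℝ} {k : ℕ} (h : trunc s k = trunc t k) :
    node ρ (code s) k = node ρ (code t) k := by
  induction k with
  | zero => rfl
  | succ k ih =>
    have h1 := ih (trunc_congr h k k.le_succ)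
    have h2 : code s k = code t k := by
      funext j
      ext
      simp only [code, h]
    funext j
    simp only [node, h1, h2]

lemma trunc_zero {t : Fin n → ℝ} (ht : ∀ j, t j ∈ Ico (0 : ℝ) 1) : trunc t 0 = 0 := by
  funext j
  simpa [trunc, digits, Nat.floor_eq_zero] using (ht j).2

lemma exists_trunc_ne {s t : Fin n → ℝ} (hs : ∀ j, s j ∈ Ico (0 : ℝ) 1)
    (ht : ∀ j, t j ∈ Ico (0 : ℝ) 1) (hst : s ≠ t) :
    ∃ k, trunc s k = trunc t k ∧ trunc s (k + 1) ≠ trunc t (k + 1) := by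
  by_contra! H
  have hall : ∀ k, trunc s k = trunc t k := by
    intro k
    induction k with
    | zero => rw [trunc_zero hs, trunc_zero ht]
    | succ k ih => exact H k ih
  obtain ⟨j, hj⟩ := Function.ne_iff.1 hst
  have hpos : 0 < |s j - t j| := abs_pos.2 (sub_ne_zero.2 hj)
  obtain ⟨k, hk⟩ := exists_pow_lt_of_lt_one hpos (show (1 / 2 : ℝ) < 1 by norm_num)
  have h1 := congrFun (hall k) j
  have hp : (0 : ℝ) < 2 ^ digits k := by positivity
  have hs1 := Nat.floor_le (mul_nonneg hp.le (hs j).1)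
  have hs2 := Nat.lt_floor_add_one (2 ^ digits k * s j)
  have ht1 := Nat.floor_le (mul_nonneg hp.le (ht j).1)
  have ht2 := Nat.lt_floor_add_one (2 ^ digits k * t j)
  simp only [trunc] at h1
  rw [h1] at hs1 hs2
  have h2 : 2 ^ digits k * |s j - t j| < 1 := by
    rw [← abs_of_pos hp, ← abs_mul, abs_lt]
    constructor <;> nlinarith
  have h3 : (2 : ℝ) ^ k ≤ 2 ^ digits k := pow_le_pow_right₀ (by norm_num) (le_digits k)
  have h4 : (2 : ℝ) ^ k * (1 / 2) ^ k = 1 := by rw [← mul_pow]; norm_num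
  have h5 : (2 : ℝ) ^ k * (1 / 2) ^ k < 2 ^ k * |s j - t j| := by gcongr
  nlinarith

/-- For `k ≥ 1`, `gap k` is about `4 * scale k = 4 * (k + 1) * gap (k - 1)`, while `digits k ≥ k *
gap (k - 1)`; the ratio tends to at most `4`, and `C` absorbs the small `k`. -/
lemma gap_le (θ : ℝ) (hθ : θ < 1 / 4) (hθ0 : 0 < θ) :
    ∃ C : ℝ, ∀ k, θ * gap k ≤ digits k + C := by
  obtain ⟨K, hK⟩ := exists_nat_gt (2 / (1 - 4 * θ))
  have h0 : 0 < 1 - 4 * θ := by linarith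
  refine ⟨∑ k ∈ Finset.range (K + 1), (gap k : ℝ), fun k => ?_⟩
  by_cases hk : k < K + 1
  · have h1 : (gap k : ℝ) ≤ ∑ k ∈ Finset.range (K + 1), (gap k : ℝ) :=
      Finset.single_le_sum (f := fun k => (gap k : ℝ)) (fun i _ => by positivity)
        (Finset.mem_range.2 hk)
    have h2 : (0 : ℝ) ≤ gap k := by positivity
    have h3 : (0 : ℝ) ≤ digits k := by positivity
    nlinarith
  · obtain ⟨j, rfl⟩ : ∃ j, k = j + 1 := ⟨k - 1, by omega⟩
    have hj : (K : ℝ) ≤ j := by exact_mod_cast (by omega : K ≤ j)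
    have h1 : (digits (j + 1) : ℝ) ≥ (j + 1) * gap j := by
      rw [digits]; push_cast
      have : (0 : ℝ) ≤ digits j := by positivity
      linarith
    have h2 : (gap (j + 1) : ℝ) = 4 * ((j + 2) * gap j) + 3 * j + 4 := by
      rw [gap, scale_succ]; push_cast; ring
    have h3 : (3 * j + 4 : ℝ) ≤ 4 * gap j := by
      have : 3 * j + 4 ≤ 4 * gap j := by unfold gap; omega
      exact_mod_cast this
    have h4 : 2 < (1 - 4 * θ) * j := by
      rw [div_lt_iff₀ h0] at hK
      nlinarith
    have h5 : (0 : ℝ) ≤ ∑ k ∈ Finset.range (K + 1), (gap k : ℝ) := by positivity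
    have h6 : (0 : ℝ) ≤ gap j := by positivity
    rw [h2]
    have h7 : θ * (4 * ((j + 2) * gap j) + 3 * j + 4) ≤ (4 * θ * (j + 2) + 1) * gap j := by
      nlinarith
    have h8 : (4 * θ * (j + 2) + 1) * gap j ≤ (j + 1) * gap j := by
      apply mul_le_mul_of_nonneg_right _ h6
      nlinarith
    linarith

/-- `D` is the largest digit difference at the first stage where the codes differ. The parents,
hence the residues, agree there, so corners differ by `2 ^ (k + 1) * D ≥ 2 * D` fine steps; the
child boxes cost at most one. -/
lemma dist_le_of_trunc [NeZero n] (hρ : ∀ k p j, ρ k p j ≤ 1) {s t : Fin n → ℝ}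
    (hs : ∀ j, s j ∈ Ico (0 : ℝ) 1) (ht : ∀ j, t j ∈ Ico (0 : ℝ) 1) {k : ℕ}
    (h : trunc s k = trunc t k) (h' : trunc s (k + 1) ≠ trunc t (k + 1)) :
    ∃ D : ℝ, 1 ≤ D ∧ D ≤ 2 ^ ((k + 1) * gap k) ∧ dist s t ≤ 2 * D / 2 ^ digits (k + 1) ∧
      D / 2 ^ scale (k + 1) ≤ dist (point ρ (code s)) (point ρ (code t)) := by
  obtain ⟨i, hi⟩ := Finite.exists_max fun j =>
    |(trunc s (k + 1) j : ℝ) - trunc t (k + 1) j|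
  have hdiff (j : Fin n) : (trunc s (k + 1) j : ℝ) - trunc t (k + 1) j
      = (code s k j : ℕ) - (code t k j : ℕ) := by
    rw [trunc_succ, trunc_succ, h]; push_cast; ring
  have hD : 1 ≤ |(trunc s (k + 1) i : ℝ) - trunc t (k + 1) i| := by
    obtain ⟨j, hj⟩ := Function.ne_iff.1 h'
    refine le_trans ?_ (hi j)
    have : (1 : ℤ) ≤ |(trunc s (k + 1) j : ℤ) - trunc t (k + 1) j| :=
      Int.one_le_abs (sub_ne_zero.2 (by exact_mod_cast hj))
    exact_mod_cast this
  set D := |(trunc s (k + 1) i : ℝ) - trunc t (k + 1) i| with hDdef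
  refine ⟨D, hD, ?_, ?_, ?_⟩
  · rw [hDdef, hdiff, abs_le]
    have h1 : ((code s k i : ℕ) : ℝ) ≤ 2 ^ ((k + 1) * gap k) := by
      exact_mod_cast (code s k i).2.le
    have h2 : ((code t k i : ℕ) : ℝ) ≤ 2 ^ ((k + 1) * gap k) := by
      exact_mod_cast (code t k i).2.le
    have h3 : (0 : ℝ) ≤ (code s k i : ℕ) := by positivity
    have h4 : (0 : ℝ) ≤ (code t k i : ℕ) := by positivity
    constructor <;> linarith
  · refine (dist_pi_le_iff (by positivity)).2 fun j => ?_
    have hp : (0 : ℝ) < 2 ^ digits (k + 1) := by positivity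
    have hs1 := Nat.floor_le (mul_nonneg hp.le (hs j).1)
    have hs2 := Nat.lt_floor_add_one (2 ^ digits (k + 1) * s j)
    have ht1 := Nat.floor_le (mul_nonneg hp.le (ht j).1)
    have ht2 := Nat.lt_floor_add_one (2 ^ digits (k + 1) * t j)
    have hj := abs_le.1 (hi j)
    simp only [trunc] at hj
    rw [le_div_iff₀ hp, Real.dist_eq, mul_comm, ← abs_of_pos hp, ← abs_mul, abs_le]
    constructor <;> linarith [hj.1, hj.2]
  · refine le_trans ?_ (dist_le_pi_dist _ _ i)
    have hnode := node_code_congr (ρ := ρ) h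
    have h1 := point_mem_Icc hρ (code s) (k + 1) i
    have h2 := point_mem_Icc hρ (code t) (k + 1) i
    rw [pt_node_succ] at h1 h2
    rw [hnode] at h1
    have h3 := side_le (k + 1)
    have hp : (0 : ℝ) < 2 ^ scale (k + 1) := by positivity
    have hDk : 2 * D ≤ 2 ^ (k + 1) * D := by
      have : (2 : ℝ) ≤ 2 ^ (k + 1) := by
        calc (2 : ℝ) = 2 ^ 1 := by norm_num
          _ ≤ _ := pow_le_pow_right₀ (by norm_num) (by omega)
      gcongr
    have h4 : (2 : ℝ) ^ (k + 1) * D / 2 ^ scale (k + 1) - 1 / 2 ^ scale (k + 1)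
        ≤ dist (point ρ (code s) i) (point ρ (code t) i) := by
      rw [Real.dist_eq]
      have h5 : (2 : ℝ) ^ (k + 1) * D / 2 ^ scale (k + 1) =
          |2 ^ (k + 1) * (((code s k i : ℕ) : ℝ) - (code t k i : ℕ)) / 2 ^ scale (k + 1)| := by
        rw [abs_div, abs_mul, ← hdiff, ← hDdef]; simp
      rw [h5, sub_le_iff_le_add]
      have h6 : 2 ^ (k + 1) * (((code s k i : ℕ) : ℝ) - (code t k i : ℕ)) / 2 ^ scale (k + 1)
          = (2 ^ (k + 1) * (code s k i : ℕ) + ρ k (pt k (node ρ (code t) k)) i)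
              / 2 ^ scale (k + 1) -
            (2 ^ (k + 1) * (code t k i : ℕ) + ρ k (pt k (node ρ (code t) k)) i)
              / 2 ^ scale (k + 1) := by ring
      rw [h6, abs_le]
      have h7 := neg_abs_le (point ρ (code s) i - point ρ (code t) i)
      have h8 := le_abs_self (point ρ (code s) i - point ρ (code t) i)
      constructor <;> linarith [h1.1, h1.2, h2.1, h2.2]
    refine le_trans ?_ h4
    rw [← sub_div]
    gcongr
    linarith

lemma dist_le_rpow [NeZero n] (hρ : ∀ k p j, ρ k p j ≤ 1) {θ C : ℝ} (hθ0 : 0 < θ) (hθ : θ ≤ 1)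
    (hC : ∀ k, θ * gap k ≤ digits k + C) {s t : Fin n → ℝ}
    (hs : ∀ j, s j ∈ Ico (0 : ℝ) 1) (ht : ∀ j, t j ∈ Ico (0 : ℝ) 1) :
    dist s t ≤ 2 * 2 ^ C * dist (point ρ (code s)) (point ρ (code t)) ^ θ := by
  rcases eq_or_ne s t with rfl | hst
  · rw [dist_self]; positivity
  obtain ⟨k, h, h'⟩ := exists_trunc_ne hs ht hst
  obtain ⟨D, hD1, hD2, hD3, hD4⟩ := dist_le_of_trunc hρ hs ht h h'
  have hD0 : 0 < D := by linarith
  refine hD3.trans ?_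
  have hx : D / 2 ^ ((k + 1) * gap k) ≤ (D / 2 ^ ((k + 1) * gap k)) ^ θ :=
    Real.self_le_rpow_of_le_one (by positivity) (by rw [div_le_one (by positivity)]; exact hD2) hθ
  have hy : D / 2 ^ ((k + 1) * gap k) = D / 2 ^ scale (k + 1) * 2 ^ gap k := by
    rw [scale_succ, pow_add]; field_simp
  have hz : ((2 : ℝ) ^ gap k) ^ θ ≤ 2 ^ digits k * 2 ^ C := by
    rw [← Real.rpow_natCast 2 (gap k), ← Real.rpow_mul (by norm_num),
      ← Real.rpow_natCast 2 (digits k), ← Real.rpow_add (by norm_num)]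
    exact Real.rpow_le_rpow_of_exponent_le (by norm_num) (by linarith [hC k])
  calc 2 * D / 2 ^ digits (k + 1) = 2 / 2 ^ digits k * (D / 2 ^ ((k + 1) * gap k)) := by
        rw [digits, pow_add]; field_simp
    _ ≤ 2 / 2 ^ digits k * (D / 2 ^ scale (k + 1) * 2 ^ gap k) ^ θ := by
        rw [← hy]; gcongr
    _ = 2 / 2 ^ digits k * ((D / 2 ^ scale (k + 1)) ^ θ * (2 ^ gap k) ^ θ) := by
        rw [Real.mul_rpow (by positivity) (by positivity)]
    _ ≤ 2 / 2 ^ digits k *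
        (dist (point ρ (code s)) (point ρ (code t)) ^ θ * (2 ^ digits k * 2 ^ C)) := by
        gcongr
    _ = _ := by field_simp

lemma le_dimH_range_point [NeZero n] (hρ : ∀ k p j, ρ k p j ≤ 1) :
    (n : ℝ≥0∞) / 4 ≤ dimH (range (point (n := n) ρ)) := by
  have main : ∀ θ : NNReal, 0 < θ → (θ : ℝ) < 1 / 4 →
      (n : ℝ≥0∞) * θ ≤ dimH (range (point (n := n) ρ)) := by
    intro θ hθ0 hθ
    obtain ⟨C, hC⟩ := gap_le θ hθ hθ0
    -- In the sup metric this ball is the open unit cube, of dimension `n`.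
    let B : Set (Fin n → ℝ) := Metric.ball (fun _ => 1 / 2) (1 / 2)
    have hB : ∀ t ∈ B, ∀ j, t j ∈ Ico (0 : ℝ) 1 := by
      intro t htB j
      have h1 := (dist_le_pi_dist t _ j).trans_lt htB
      rw [Real.dist_eq, abs_lt] at h1
      constructor <;> linarith [h1.1, h1.2]
    let h : (Fin n → ℝ) → Fin n → ℝ := fun t => point ρ (code t)
    have hd : ∀ s ∈ B, ∀ t ∈ B, dist s t ≤ 2 * 2 ^ C * dist (h s) (h t) ^ (θ : ℝ) :=
      fun s hs t ht => dist_le_rpow hρ hθ0 (hθ.le.trans (by norm_num)) hC (hB s hs) (hB t ht)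
    have hinj : InjOn h B := by
      intro s hs t ht hst
      have := hd s hs t ht
      rw [hst, dist_self, Real.zero_rpow (by exact_mod_cast hθ0.ne'), mul_zero] at this
      exact dist_le_zero.1 this
    have hleft := hinj.leftInvOn_invFunOn
    have hH : HolderOnWith (2 * 2 ^ C : ℝ).toNNReal θ (Function.invFunOn h B) (h '' B) := by
      rintro _ ⟨s, hs, rfl⟩ _ ⟨t, ht, rfl⟩
      rw [hleft hs, hleft ht, edist_dist, edist_dist, ENNReal.ofReal_rpow_of_nonneg dist_nonneg
        θ.coe_nonneg]
      change _ ≤ ENNReal.ofReal (2 * 2 ^ C) * _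
      rw [← ENNReal.ofReal_mul (by positivity)]
      exact ENNReal.ofReal_le_ofReal (hd s hs t ht)
    have h1 := hH.dimH_image_le hθ0
    rw [hleft.image_image, Real.dimH_ball_pi _ (by norm_num), Fintype.card_fin,
      ENNReal.le_div_iff_mul_le (by simp [hθ0.ne']) (by simp)] at h1
    refine h1.trans (dimH_mono ?_)
    rintro _ ⟨t, -, rfl⟩
    exact ⟨_, rfl⟩
  refine le_of_forall_lt_imp_le_of_dense fun c hc => ?_
  have hn : (0 : ℝ) < n := by exact_mod_cast Nat.pos_of_ne_zero (NeZero.ne n)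
  lift c to NNReal using hc.ne_top
  rcases eq_or_ne c 0 with rfl | hc0
  · simp
  have hc' : (c : ℝ) < n / 4 := by
    have : ((n / 4 : NNReal) : ℝ≥0∞) = (n : ℝ≥0∞) / 4 := by
      rw [ENNReal.coe_div (by norm_num)]; simp
    rw [← this, ENNReal.coe_lt_coe] at hc
    exact_mod_cast hc
  have hnn : (n : NNReal) ≠ 0 := by exact_mod_cast NeZero.ne n
  have := main (c / n) (by positivity) (by
    rw [NNReal.coe_div, NNReal.coe_natCast, div_lt_iff₀ hn]; linarith)
  refine le_trans (le_of_eq ?_) this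
  rw [← ENNReal.coe_natCast, ← ENNReal.coe_mul, mul_div_cancel₀ _ hnn]

end

/-! ### Prescribed residues and the exclusion of angles -/

section

open Set Filter Topology

variable {n : ℕ} {ρ : ℕ → (Fin n → ℝ) → Fin n → ℕ}

/-- The direction at the second point: parallel to the first direction if `q = 0`, and
orthogonal to it otherwise. -/
def direction (i₀ i₁ : Fin n) (q : ℚ) : Fin n → ℕ :=
  if q = 0 then Pi.single i₀ 1 else Pi.single i₁ 1

/-- Rational `q`, centres from a dense sequence and radii `1 / (l + 1)` give countably many
patterns; `ρ` runs through an enumeration repeating each one infinitely often. -/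
lemma exists_residues (i₀ i₁ : Fin n) :
    ∃ ρ : ℕ → (Fin n → ℝ) → Fin n → ℕ, (∀ k p j, ρ k p j ≤ 1) ∧
      ∀ (q : ℚ) (x z : Fin n → ℝ) (r : ℝ), 0 < r → 3 * r ≤ dist x z →
        ∃ δ > 0, ∃ᶠ k in atTop, (∀ p, dist p x < δ → ρ k p = Pi.single i₀ 1) ∧
          (∀ p, dist p z < δ → ρ k p = direction i₀ i₁ q) ∧
          (∀ p, 2 * r ≤ dist p x → 2 * r ≤ dist p z → ρ k p = 0) := by
  classical
  obtain ⟨f, hf⟩ := exists_surjective_nat (ℚ × ℕ × ℕ × ℕ)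
  let c : ℕ → Fin n → ℝ := TopologicalSpace.denseSeq (Fin n → ℝ)
  have hc : DenseRange c := TopologicalSpace.denseRange_denseSeq _
  have hsingle : ∀ i j : Fin n, (Pi.single i 1 : Fin n → ℕ) j ≤ 1 := by
    intro i j
    rw [Pi.single_apply]
    split_ifs <;> simp
  let σ : ℚ × ℕ × ℕ × ℕ → (Fin n → ℝ) → Fin n → ℕ := fun τ p =>
    if dist p (c τ.2.1) < 1 / (τ.2.2.2 + 1) then Pi.single i₀ 1
    else if dist p (c τ.2.2.1) < 1 / (τ.2.2.2 + 1) then direction i₀ i₁ τ.1 else 0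
  refine ⟨fun k => σ (f k.unpair.1), fun k p j => ?_, fun q x z r hr hxz => ?_⟩
  · simp only [σ, direction]
    split_ifs <;> simp [hsingle]
  obtain ⟨l, hl⟩ := exists_nat_one_div_lt hr
  set ε : ℝ := 1 / ((l : ℝ) + 1) with hε
  have hε0 : 0 < ε := by positivity
  obtain ⟨i, hi⟩ := hc.exists_dist_lt x (half_pos hε0)
  obtain ⟨i', hi'⟩ := hc.exists_dist_lt z (half_pos hε0)
  obtain ⟨m, hm⟩ := hf (q, i, i', l)
  -- Unpairing `Nat.pair m K` returns the pattern index `m`, at a stage at least `K`.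
  refine ⟨ε / 2, half_pos hε0, frequently_atTop.2 fun K =>
    ⟨Nat.pair m K, Nat.right_le_pair m K, ?_⟩⟩
  simp only [Nat.unpair_pair, hm, σ]
  refine ⟨fun p hp => ?_, fun p hp => ?_, fun p hpx hpz => ?_⟩
  · rw [if_pos]
    linarith [dist_triangle p x (c i)]
  · rw [if_neg, if_pos]
    · linarith [dist_triangle p z (c i')]
    · have := dist_triangle x p z
      have := dist_triangle p (c i) x
      rw [dist_comm x p] at *
      rw [dist_comm (c i) x] at *
      linarith
  · have := dist_triangle p (c i) x
    have := dist_triangle p (c i') z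
    rw [dist_comm (c i) x] at *
    rw [dist_comm (c i') z] at *
    rw [if_neg (by linarith), if_neg (by linarith)]

lemma node_succ_cast (ω : Code n) (k : ℕ) (j : Fin n) :
    (node ρ ω (k + 1) j : ZMod (2 ^ (k + 1))) = ρ k (pt k (node ρ ω k)) j := by
  have h1 : ((2 ^ (k + 1) : ℕ) : ZMod (2 ^ (k + 1))) = 0 := ZMod.natCast_self _
  have h2 : ((2 ^ (scale (k + 1) - scale k) : ℕ) : ZMod (2 ^ (k + 1))) = 0 := by
    rw [ZMod.natCast_eq_zero_iff]
    exact pow_dvd_pow 2 (by have := scale_add_lt k; omega)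
  rw [node, Nat.cast_add, Nat.cast_add, Nat.cast_mul, Nat.cast_mul, h1, h2]
  ring

/-- The quartic form expressing that the squared cosine of the angle between `u` and `w`
is `q`. -/
def angleForm {R : Type*} [CommRing R] (q : ℚ) (u w : Fin n → R) : R :=
  q.den * (u ⬝ᵥ w) ^ 2 - q.num * ((u ⬝ᵥ u) * (w ⬝ᵥ w))

lemma angleForm_map {R S : Type*} [CommRing R] [CommRing S] (f : R →+* S) (q : ℚ)
    (u w : Fin n → R) : f (angleForm q u w) = angleForm q (f ∘ u) (f ∘ w) := by
  simp [angleForm, RingHom.map_dotProduct]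

lemma angleForm_smul {R : Type*} [CommRing R] (c : R) (q : ℚ) (u w : Fin n → R) :
    angleForm q (c • u) (c • w) = c ^ 4 * angleForm q u w := by
  simp only [angleForm, smul_dotProduct, dotProduct_smul, smul_eq_mul]
  ring

lemma angleForm_int_ne_zero {i₀ i₁ : Fin n} (hi : i₀ ≠ i₁) {M : ℕ} {q : ℚ} (hM : 1 < M)
    (hq : q.num.natAbs < M) {U W : Fin n → ℤ}
    (hU : ∀ j, (U j : ZMod M) = (Pi.single i₀ 1 : Fin n → ℕ) j)
    (hW : ∀ j, (W j : ZMod M) = direction i₀ i₁ q j) : angleForm q U W ≠ 0 := by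
  have : Fact (1 < M) := ⟨hM⟩
  have hs : ∀ i : Fin n, (fun j => (((Pi.single i 1 : Fin n → ℕ) j : ℕ) : ZMod M))
      = Pi.single i 1 := by
    intro i
    funext j
    by_cases h : j = i
    · subst h; simp
    · simp [h]
  have hU' : (Int.castRingHom (ZMod M)) ∘ U = Pi.single i₀ 1 := by
    rw [← hs]; funext j; exact hU j
  intro h0
  have h1 := angleForm_map (Int.castRingHom (ZMod M)) q U W
  rw [h0, map_zero, hU'] at h1
  by_cases h : q = 0
  · have hW' : (Int.castRingHom (ZMod M)) ∘ W = Pi.single i₀ 1 := by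
      rw [← hs]; funext j; simpa [direction, h] using hW j
    rw [hW'] at h1
    simp [angleForm, h] at h1
  · have hW' : (Int.castRingHom (ZMod M)) ∘ W = Pi.single i₁ 1 := by
      rw [← hs]; funext j; simpa [direction, h] using hW j
    rw [hW'] at h1
    simp [angleForm, hi.symm] at h1
    rw [ZMod.intCast_zmod_eq_zero_iff_dvd, Int.natCast_dvd] at h1
    have := Nat.le_of_dvd (by simpa [Int.natAbs_pos] using h) h1
    omega

lemma abs_dotProduct_le {B : ℝ} {s t : Fin n → ℝ} (hs : ∀ j, |s j| ≤ B)
    (ht : ∀ j, |t j| ≤ B) : |s ⬝ᵥ t| ≤ n * B ^ 2 := by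
  refine (Finset.abs_sum_le_sum_abs _ _).trans ?_
  refine (Finset.sum_le_card_nsmul _ _ (B ^ 2) fun j _ => ?_).trans (by simp)
  rw [abs_mul, sq]
  exact mul_le_mul (hs j) (ht j) (abs_nonneg _) ((abs_nonneg _).trans (hs j))

lemma abs_dotProduct_sub_le {B η : ℝ} {s t u w : Fin n → ℝ} (hs : ∀ j, |s j| ≤ B)
    (hw : ∀ j, |w j| ≤ B) (hsu : ∀ j, |s j - u j| ≤ η) (htw : ∀ j, |t j - w j| ≤ η) :
    |s ⬝ᵥ t - u ⬝ᵥ w| ≤ n * (2 * B * η) := by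
  rw [dotProduct, dotProduct, ← Finset.sum_sub_distrib]
  refine (Finset.abs_sum_le_sum_abs _ _).trans ?_
  refine (Finset.sum_le_card_nsmul _ _ (2 * B * η) fun j _ => ?_).trans (by simp)
  have hB : 0 ≤ B := (abs_nonneg _).trans (hs j)
  have hη : 0 ≤ η := (abs_nonneg _).trans (hsu j)
  calc |s j * t j - u j * w j| = |s j * (t j - w j) + (s j - u j) * w j| := by congr 1; ring
    _ ≤ |s j| * |t j - w j| + |s j - u j| * |w j| := by
        rw [← abs_mul, ← abs_mul]; exact abs_add_le _ _
    _ ≤ B * η + η * B := by gcongr <;> first | exact hs j | exact htw j | exact hsu j | exact hw j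
    _ = 2 * B * η := by ring

lemma abs_mul_sub_mul_le {G e a b a' b' : ℝ} (ha : |a| ≤ G) (hb' : |b'| ≤ G)
    (haa : |a - a'| ≤ e) (hbb : |b - b'| ≤ e) : |a * b - a' * b'| ≤ 2 * G * e := by
  have hG : 0 ≤ G := (abs_nonneg _).trans ha
  have he : 0 ≤ e := (abs_nonneg _).trans haa
  calc |a * b - a' * b'| = |a * (b - b') + (a - a') * b'| := by congr 1; ring
    _ ≤ |a| * |b - b'| + |a - a'| * |b'| := by
        rw [← abs_mul, ← abs_mul]; exact abs_add_le _ _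
    _ ≤ G * e + e * G := by gcongr
    _ = 2 * G * e := by ring

lemma abs_angleForm_sub_le {B η : ℝ} (q : ℚ) {s t u w : Fin n → ℝ} (hs : ∀ j, |s j| ≤ B)
    (ht : ∀ j, |t j| ≤ B) (hu : ∀ j, |u j| ≤ B) (hw : ∀ j, |w j| ≤ B)
    (hsu : ∀ j, |s j - u j| ≤ η) (htw : ∀ j, |t j - w j| ≤ η) :
    |angleForm q s t - angleForm q u w| ≤ (q.den + |(q.num : ℝ)|) * (4 * n ^ 2 * B ^ 3 * η) := by
  have h1 := abs_mul_sub_mul_le (abs_dotProduct_le hs ht) (abs_dotProduct_le hu hw)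
    (abs_dotProduct_sub_le hs hw hsu htw) (abs_dotProduct_sub_le hs hw hsu htw)
  have h2 := abs_mul_sub_mul_le (abs_dotProduct_le hs hs) (abs_dotProduct_le hw hw)
    (abs_dotProduct_sub_le hs hu hsu hsu) (abs_dotProduct_sub_le ht hw htw htw)
  have h3 : angleForm q s t - angleForm q u w =
      q.den * ((s ⬝ᵥ t) * (s ⬝ᵥ t) - (u ⬝ᵥ w) * (u ⬝ᵥ w)) -
      q.num * ((s ⬝ᵥ s) * (t ⬝ᵥ t) - (u ⬝ᵥ u) * (w ⬝ᵥ w)) := by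
    simp only [angleForm]; ring
  rw [h3]
  refine (abs_sub _ _).trans ?_
  rw [abs_mul, abs_mul, add_mul, Nat.abs_cast]
  have h4 : 2 * (n * B ^ 2) * (n * (2 * B * η)) = 4 * n ^ 2 * B ^ 3 * η := by ring
  rw [h4] at h1 h2
  gcongr

/-- The integer form is nonzero by its residue, hence at least `1` in absolute value, and the
rescaled real form is within less than `1` of it. -/
lemma angleForm_ne_zero_of_residues (hρ : ∀ k p j, ρ k p j ≤ 1) {i₀ i₁ : Fin n} (hi : i₀ ≠ i₁)
    {q : ℚ} {k : ℕ} (hq : q.num.natAbs < 2 ^ (k + 1))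
    (hk : (q.den + |(q.num : ℝ)|) * (4 * n ^ 2) < 4 ^ (k + 1)) {ωx ωy ωz ωv : Code n}
    (hx : ρ k (pt k (node ρ ωx k)) = Pi.single i₀ 1) (hy : ρ k (pt k (node ρ ωy k)) = 0)
    (hz : ρ k (pt k (node ρ ωz k)) = direction i₀ i₁ q) (hv : ρ k (pt k (node ρ ωv k)) = 0) :
    angleForm q (point ρ ωx - point ρ ωy) (point ρ ωz - point ρ ωv) ≠ 0 := by
  set N : ℝ := 2 ^ scale (k + 1) with hN
  have hN0 : 0 < N := by positivity
  have close : ∀ ω ω' : Code n, ∀ j, |(N • (point ρ ω - point ρ ω')) j| ≤ N ∧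
      |(((node ρ ω (k + 1) j : ℤ) - (node ρ ω' (k + 1) j : ℤ) : ℤ) : ℝ)| ≤ N ∧
      |(N • (point ρ ω - point ρ ω')) j -
        (((node ρ ω (k + 1) j : ℤ) - (node ρ ω' (k + 1) j : ℤ) : ℤ) : ℝ)| ≤
        N * side (k + 1) := by
    intro ω ω' j
    have h1 := point_mem_unit hρ ω j
    have h2 := point_mem_unit hρ ω' j
    have h3 := point_mem_Icc hρ ω (k + 1) j
    have h4 := point_mem_Icc hρ ω' (k + 1) j
    have hp : ∀ ω : Code n, (node ρ ω (k + 1) j : ℝ) = N * pt (k + 1) (node ρ ω (k + 1)) j := by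
      intro ω; rw [pt, ← hN]; field_simp
    have h5 : 0 ≤ pt (k + 1) (node ρ ω (k + 1)) j := by unfold pt; positivity
    have h6 : 0 ≤ pt (k + 1) (node ρ ω' (k + 1)) j := by unfold pt; positivity
    push_cast
    rw [hp, hp, Pi.smul_apply, smul_eq_mul, Pi.sub_apply, ← mul_sub, ← mul_sub, abs_mul, abs_mul,
      abs_mul, abs_of_pos hN0]
    refine ⟨mul_le_of_le_one_right hN0.le ?_, mul_le_of_le_one_right hN0.le ?_,
      mul_le_mul_of_nonneg_left ?_ hN0.le⟩ <;> rw [abs_le] <;>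
      constructor <;> linarith [h1.1, h1.2, h2.1, h2.2, h3.1, h3.2, h4.1, h4.2]
  set U : Fin n → ℤ := fun j => (node ρ ωx (k + 1) j : ℤ) - (node ρ ωy (k + 1) j : ℤ) with hU
  set W : Fin n → ℤ := fun j => (node ρ ωz (k + 1) j : ℤ) - (node ρ ωv (k + 1) j : ℤ) with hW
  have hint : angleForm q U W ≠ 0 := by
    refine angleForm_int_ne_zero hi (Nat.one_lt_two_pow k.succ_ne_zero) hq (fun j => ?_)
      (fun j => ?_)
    · rw [hU]; push_cast; rw [node_succ_cast, node_succ_cast, hx, hy]; simp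
    · rw [hW]; push_cast; rw [node_succ_cast, node_succ_cast, hz, hv]; simp
  have hone : 1 ≤ |angleForm q ((Int.castRingHom ℝ) ∘ U) ((Int.castRingHom ℝ) ∘ W)| := by
    rw [← angleForm_map]
    rw [eq_intCast]
    exact_mod_cast Int.one_le_abs hint
  have hb := abs_angleForm_sub_le (B := N) (η := N * side (k + 1)) q
    (s := N • (point ρ ωx - point ρ ωy)) (t := N • (point ρ ωz - point ρ ωv))
    (u := (Int.castRingHom ℝ) ∘ U) (w := (Int.castRingHom ℝ) ∘ W)
    (fun j => (close ωx ωy j).1) (fun j => (close ωz ωv j).1)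
    (fun j => (close ωx ωy j).2.1) (fun j => (close ωz ωv j).2.1)
    (fun j => (close ωx ωy j).2.2) (fun j => (close ωz ωv j).2.2)
  intro h0
  rw [angleForm_smul, h0, mul_zero, zero_sub, abs_neg] at hb
  -- The `4 * scale` in `side` cancels `N ^ 4`; the extra `2 * k` leaves the decaying factor.
  have hside : N ^ 3 * (N * side (k + 1)) = 1 / 4 ^ (k + 1) := by
    rw [side, hN, pow_add, mul_comm 4, pow_mul _ (scale (k + 1)), pow_mul _ 2 (k + 1)]
    norm_num
    field_simp
  have : (q.den + |(q.num : ℝ)|) * (4 * n ^ 2 * N ^ 3 * (N * side (k + 1))) < 1 := by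
    rw [mul_assoc (4 * (n : ℝ) ^ 2), hside, ← mul_assoc, mul_one_div, div_lt_one (by positivity)]
    exact hk
  linarith

/-- The points `y` and `v` may coincide, as both get residue `0`; this is what covers angles with a
common vertex. -/
lemma angleForm_ne_zero (hρ : ∀ k p j, ρ k p j ≤ 1) {i₀ i₁ : Fin n} (hi : i₀ ≠ i₁)
    (hρ' : ∀ (q : ℚ) (x z : Fin n → ℝ) (r : ℝ), 0 < r → 3 * r ≤ dist x z →
        ∃ δ > 0, ∃ᶠ k in atTop, (∀ p, dist p x < δ → ρ k p = Pi.single i₀ 1) ∧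
          (∀ p, dist p z < δ → ρ k p = direction i₀ i₁ q) ∧
          (∀ p, 2 * r ≤ dist p x → 2 * r ≤ dist p z → ρ k p = 0))
    (q : ℚ) {x y z v : Fin n → ℝ} (hx : x ∈ range (point ρ)) (hy : y ∈ range (point ρ))
    (hz : z ∈ range (point ρ)) (hv : v ∈ range (point ρ)) (hxz : x ≠ z) (hxy : x ≠ y)
    (hxv : x ≠ v) (hzy : z ≠ y) (hzv : z ≠ v) : angleForm q (x - y) (z - v) ≠ 0 := by
  obtain ⟨r, hr, h1, h2, h3, h4, h5⟩ : ∃ r > 0, 3 * r ≤ dist x z ∧ 3 * r ≤ dist x y ∧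
      3 * r ≤ dist x v ∧ 3 * r ≤ dist z y ∧ 3 * r ≤ dist z v := by
    have hsmall : ∀ {p p' : Fin n → ℝ}, p ≠ p' → ∀ᶠ r : ℝ in 𝓝[>] 0, 3 * r ≤ dist p p' := by
      intro p p' h
      filter_upwards [Ioo_mem_nhdsGT (div_pos (dist_pos.2 h) three_pos)] with r hr
      linarith [hr.2]
    obtain ⟨r, h⟩ := ((hsmall hxz).and <| (hsmall hxy).and <| (hsmall hxv).and <|
      (hsmall hzy).and <| (hsmall hzv).and self_mem_nhdsWithin).exists
    exact ⟨r, h.2.2.2.2.2, h.1, h.2.1, h.2.2.1, h.2.2.2.1, h.2.2.2.2.1⟩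
  obtain ⟨δ, hδ, hfreq⟩ := hρ' q x z r hr h1
  have hp2 : Tendsto (fun k : ℕ => (2 : ℕ) ^ (k + 1)) atTop atTop :=
    (tendsto_pow_atTop_atTop_of_one_lt one_lt_two).comp (tendsto_add_atTop_nat 1)
  have hp4 : Tendsto (fun k : ℕ => (4 : ℝ) ^ (k + 1)) atTop atTop :=
    (tendsto_pow_atTop_atTop_of_one_lt (by norm_num)).comp (tendsto_add_atTop_nat 1)
  obtain ⟨k, ⟨kx, kz, k0⟩, kδ, kr, kq, k4⟩ := (hfreq.and_eventually
    ((tendsto_side.eventually (gt_mem_nhds hδ)).and <|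
      (tendsto_side.eventually (gt_mem_nhds hr)).and <|
      (hp2.eventually_gt_atTop q.num.natAbs).and <|
      hp4.eventually_gt_atTop ((q.den + |(q.num : ℝ)|) * (4 * n ^ 2)))).exists
  obtain ⟨ωx, rfl⟩ := hx
  obtain ⟨ωy, rfl⟩ := hy
  obtain ⟨ωz, rfl⟩ := hz
  obtain ⟨ωv, rfl⟩ := hv
  have hd := fun ω : Code n => dist_point_pt_le hρ ω k
  have hfar : ∀ {ω ω' : Code n}, 3 * r ≤ dist (point ρ ω) (point ρ ω') →
      2 * r ≤ dist (pt k (node ρ ω' k)) (point ρ ω) := by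
    intro ω ω' h
    have h6 := dist_triangle (point ρ ω') (pt k (node ρ ω' k)) (point ρ ω)
    rw [dist_comm (point ρ ω')] at h6
    have h7 := hd ω'
    have h8 := dist_comm (point ρ ω') (point ρ ω)
    have h9 := dist_comm (point ρ ω') (pt k (node ρ ω' k))
    linarith
  refine angleForm_ne_zero_of_residues hρ hi kq k4 (kx _ ?_) (k0 _ (hfar h2) (hfar h4)) (kz _ ?_)
    (k0 _ (hfar h3) (hfar h5))
  · rw [dist_comm]; exact (hd ωx).trans_lt kδ
  · rw [dist_comm]; exact (hd ωz).trans_lt kδ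

lemma angleForm_eq_zero_of_cos_sq {q : ℚ} {u w : EuclideanSpace ℝ (Fin n)}
    (h : Real.cos (InnerProductGeometry.angle u w) ^ 2 = (q : ℝ)) :
    angleForm q (WithLp.ofLp u) (WithLp.ofLp w) = 0 := by
  have h1 := InnerProductGeometry.cos_angle_mul_norm_mul_norm u w
  have hin : ∀ u w : EuclideanSpace ℝ (Fin n), inner ℝ u w = WithLp.ofLp u ⬝ᵥ WithLp.ofLp w := by
    intro u w
    rw [EuclideanSpace.inner_eq_star_dotProduct, dotProduct_comm]
    simp
  have hq : (q : ℝ) * q.den = q.num := by exact_mod_cast Rat.mul_den_eq_num q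
  rw [angleForm, ← hin, ← hin, ← hin, ← h1, real_inner_self_eq_norm_sq,
    real_inner_self_eq_norm_sq, ← hq, ← h]
  ring

end

end LatticeCantor

open LatticeCantor

theorem theorem3p2 (n : ℕ) (hn : 2 ≤ n) :
    ∃ E : Set (EuclideanSpace ℝ (Fin n)),
      IsCompact E ∧
      dimH E = (n : ℝ≥0∞) / 4 ∧
      (∀ x ∈ E, ∀ y ∈ E, ∀ z ∈ E, x ≠ y → x ≠ z → y ≠ z →
        ¬ ∃ q : ℚ, Real.cos (EuclideanGeometry.angle y x z) ^ 2 = (q : ℝ)) ∧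
      (∀ x ∈ E, ∀ y ∈ E, ∀ z ∈ E, ∀ v ∈ E,
        x ≠ y → x ≠ z → x ≠ v → y ≠ z → y ≠ v → z ≠ v →
        ¬ ∃ q : ℚ, Real.cos (InnerProductGeometry.angle (x - y) (z - v)) ^ 2 = (q : ℝ)) := by
  have : NeZero n := ⟨by omega⟩
  have hi : (⟨0, by omega⟩ : Fin n) ≠ ⟨1, by omega⟩ := by simp
  obtain ⟨ρ, hρ, hρ'⟩ := exists_residues (⟨0, by omega⟩ : Fin n) ⟨1, by omega⟩
  let e := PiLp.continuousLinearEquiv 2 ℝ fun _ : Fin n => ℝ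
  have key : ∀ x ∈ e.symm '' Set.range (point ρ), ∀ y ∈ e.symm '' Set.range (point ρ),
      ∀ z ∈ e.symm '' Set.range (point ρ), ∀ v ∈ e.symm '' Set.range (point ρ),
      x ≠ z → x ≠ y → x ≠ v → z ≠ y → z ≠ v →
      ¬ ∃ q : ℚ, Real.cos (InnerProductGeometry.angle (x - y) (z - v)) ^ 2 = (q : ℝ) := by
    rintro _ ⟨x, hx, rfl⟩ _ ⟨y, hy, rfl⟩ _ ⟨z, hz, rfl⟩ _ ⟨v, hv, rfl⟩ hxz hxy hxv hzy hzv ⟨q, hq⟩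
    exact angleForm_ne_zero hρ hi hρ' q hx hy hz hv (ne_of_apply_ne _ hxz) (ne_of_apply_ne _ hxy)
      (ne_of_apply_ne _ hxv) (ne_of_apply_ne _ hzy) (ne_of_apply_ne _ hzv)
      (angleForm_eq_zero_of_cos_sq hq)
  refine ⟨e.symm '' Set.range (point ρ), (isCompact_range_point hρ).image e.symm.continuous, ?_,
    fun x hx y hy z hz hxy hxz hyz => ?_, fun x hx y hy z hz v hv hxy hxz hxv hyz hyv hzv => ?_⟩
  · rw [e.symm.dimH_image]
    exact le_antisymm (dimH_range_point_le hρ) (le_dimH_range_point hρ)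
  -- The vertex `x` serves as the base point of both vectors.
  · simpa [EuclideanGeometry.angle] using key y hy x hx z hz x hx hyz hxy.symm hxy.symm hxz.symm
      hxz.symm
  · exact key x hx y hy z hz v hv hxz hxy hxv hyz.symm hzv
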